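/- **Theorem 3.3.** Let $n\ge 1$. Write $\mathbb S^n$ for the real symmetric $n\times n$ matrices, $\mathbb S^n_+$ for the cone of positive semidefinite ones, $\langle A,X\rangle=\sum_{i,j}A_{ij}X_{ij}$, $\Gamma^n=\{xx^T: x\in\mathbb R^n\}$, $H^1=\mathrm{diag}(0,\dots,0,1)\in\mathbb S^n$ and $\mathbb H^1=\{X\in\mathbb S^n:\langle H^1,X\rangle=1\}=\{X\in\mathbb S^n: X_{nn}=1\}$. For $\mathcal C\subseteq\mathbb S^n$ let $$\mathbb J_+(\mathcal C)=\{X\in\mathbb S^n_+:\langle C,X\rangle\ge 0\ \text{ for all } C\in\mathcal C\},$$ and say that the convex-hull identity holds for $\mathcal C$ if $$\mathbb J_+(\mathcal C)\cap\mathbb H^1=\overline{\mathrm{co}}\bigl(\Gamma^n\cap\mathbb J_+(\mathcal C)\cap\mathbb H^1\bigr),\qquad(\ast)$$ where $\overline{\mathrm{co}}$ is the closure of the convex hull. For $\mathbb C\subseteq\mathbb S^n_+$ and $Q\in\mathbb S^n$ put $$\eta(\mathbb C,Q,H^1)=\inf\{\langle Q,X\rangle: X\in\mathbb C,\ \langle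 H^1,X\rangle=1\}\in[-\infty,+\infty],$$ with value $+\infty$ if there is no feasible $X$. For $u\in\mathbb R^{n-1}$ and $B\in\mathbb S^n$ put $$q(u,B)=\Bigl\langle B,\begin{pmatrix}u\\1\end{pmatrix}\begin{pmatrix}u\\1\end{pmatrix}^T\Bigr\rangle,\quad B_= =\{u\in\mathbb R^{n-1}:q(u,B)=0\},\quad B_\ge=\{u\in\mathbb R^{n-1}:q(u,B)\ge0\}.$$ Let $\mathcal A,\mathcal B\subset\mathbb S^n$ be finite and let $\mathbb F$ be a face of $\mathbb S^n_+$ with $\mathbb J_+(\mathcal A)\subseteq\mathbb F$. Let $$L_1(\mathbb F)=\Bigl\{u\in\mathbb R^{n-1}:\begin{pmatrix}u\\1\end{pmatrix}\begin{pmatrix}u\\1\end{pmatrix}^T\in\mathbb F\Bigr\}.$$ Assume that 1. $(\ast)$ holds for $\mathcal C=\mathcal A$; 2. $L_1(\mathbb F)\cap B_=\subseteq L_1(\mathbb F)\cap B'_\ge$ for all $B\in\mathcal B$ and $B'\in\mathcal A\cup\mathcal B$ with $B\ne B'$; 3. for every $B\in\mathcal B$, the function $q(\cdot,B)$ is not affine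 on $L_1(\mathbb F)$, i.e. its restriction to $L_1(\mathbb F)$ does not coincide with the restriction of an affine function $\mathbb R^{n-1}\to\mathbb R$. Then $(\ast)$ holds for $\mathcal C=\mathcal A\cup\mathcal B$, and consequently $$\eta(\mathbb J_+(\mathcal A\cup\mathcal B),Q,H^1)=\eta(\Gamma^n\cap\mathbb J_+(\mathcal A\cup\mathcal B),Q,H^1)\qquad\text{for every }Q\in\mathbb S^n;$$ that is, the semidefinite relaxation and the quadratically constrained quadratic program have the same optimal value. -/

import Mathlib

noncomputable section

namespace QCQP

/-- `⟨A, X⟩ = ∑ᵢ ∑ⱼ Aᵢⱼ Xᵢⱼ`. The space `𝕊ⁿ` of symmetric matrices is modelled by real `n × n`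
matrices together with `Matrix.IsSymm`. -/
def matInner {n : ℕ} (A X : Matrix (Fin n) (Fin n) ℝ) : ℝ :=
  ∑ i, ∑ j, A i j * X i j

/-- The cone `𝕊ⁿ₊` of positive semidefinite symmetric matrices. -/
def psdCone (n : ℕ) : PointedCone ℝ (Matrix (Fin n) (Fin n) ℝ) where
  carrier := {X | X.PosSemidef}
  add_mem' := fun hX hY => hX.add hY
  zero_mem' := Matrix.PosSemidef.zero
  smul_mem' := fun c _ hX => hX.smul c.2

/-- `𝚪ⁿ = {x xᵀ : x ∈ ℝⁿ}`. -/
def rankOne (n : ℕ) : Set (Matrix (Fin n) (Fin n) ℝ) :=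
  Set.range fun x : Fin n → ℝ => Matrix.vecMulVec x x

/-- `𝕁₊(𝒜)`: the positive semidefinite `X` with `⟨A, X⟩ ≥ 0` for all `A ∈ 𝒜`. -/
def Jplus {n : ℕ} (𝒜 : Set (Matrix (Fin n) (Fin n) ℝ)) : Set (Matrix (Fin n) (Fin n) ℝ) :=
  {X | X ∈ psdCone n ∧ ∀ A ∈ 𝒜, 0 ≤ matInner A X}

/-- `η(ℂ, Q, H) = inf {⟨Q, X⟩ : X ∈ ℂ, ⟨H, X⟩ = 1}` in `[-∞, +∞]`; it is `+∞` when there is no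
feasible `X`. -/
def eta {n : ℕ} (C : Set (Matrix (Fin n) (Fin n) ℝ)) (Q H : Matrix (Fin n) (Fin n) ℝ) : EReal :=
  sInf ((fun X => ((matInner Q X : ℝ) : EReal)) '' {X | X ∈ C ∧ matInner H X = 1})

/-! For the standard form, `n = m + 1` and `u ∈ ℝⁿ⁻¹ = ℝᵐ`. -/

/-- `H¹ = diag(0, …, 0, 1)`. -/
def H₁ (m : ℕ) : Matrix (Fin (m + 1)) (Fin (m + 1)) ℝ :=
  Matrix.diagonal (Pi.single (Fin.last m) 1)

/-- `ℍ¹ = {X ∈ 𝕊ⁿ : ⟨H¹, X⟩ = 1}`, that is, `Xₙₙ = 1`. -/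
def hyperplane₁ (m : ℕ) : Set (Matrix (Fin (m + 1)) (Fin (m + 1)) ℝ) :=
  {X | X.IsSymm ∧ matInner (H₁ m) X = 1}

/-- The vector `(u, 1) ∈ ℝⁿ`. -/
def hom {m : ℕ} (u : Fin m → ℝ) : Fin (m + 1) → ℝ :=
  Fin.snoc u 1

/-- `q(u, A) = ⟨A, (u, 1)(u, 1)ᵀ⟩`. -/
def q {m : ℕ} (u : Fin m → ℝ) (A : Matrix (Fin (m + 1)) (Fin (m + 1)) ℝ) : ℝ :=
  matInner A (Matrix.vecMulVec (hom u) (hom u))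

/-- `A₌ = {u : q(u, A) = 0}`. -/
def zeroSet {m : ℕ} (A : Matrix (Fin (m + 1)) (Fin (m + 1)) ℝ) : Set (Fin m → ℝ) :=
  {u | q u A = 0}

/-- `A_≥ = {u : q(u, A) ≥ 0}`. -/
def nonnegSet {m : ℕ} (A : Matrix (Fin (m + 1)) (Fin (m + 1)) ℝ) : Set (Fin m → ℝ) :=
  {u | 0 ≤ q u A}

/-- `L₁(𝔽) = {u : (u, 1)(u, 1)ᵀ ∈ 𝔽}`. -/
def L₁ {m : ℕ} (F : PointedCone ℝ (Matrix (Fin (m + 1)) (Fin (m + 1)) ℝ)) : Set (Fin m → ℝ) :=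
  {u | Matrix.vecMulVec (hom u) (hom u) ∈ F}

/-- `f` agrees on `s` with some affine function. -/
def IsAffineOn {m : ℕ} (f : (Fin m → ℝ) → ℝ) (s : Set (Fin m → ℝ)) : Prop :=
  ∃ g : (Fin m → ℝ) →ᵃ[ℝ] ℝ, Set.EqOn f g s

/-- The identity `𝕁₊(𝒞) ∩ ℍ¹ = cl co (𝚪ⁿ ∩ 𝕁₊(𝒞) ∩ ℍ¹)`. -/
def ConvexHullIdentity {m : ℕ} (𝒞 : Set (Matrix (Fin (m + 1)) (Fin (m + 1)) ℝ)) : Prop :=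
  Jplus 𝒞 ∩ hyperplane₁ m =
    closure (convexHull ℝ (rankOne (m + 1) ∩ Jplus 𝒞 ∩ hyperplane₁ m))

end QCQP

end

namespace QCQP

open Matrix Filter Topology

/-! Only membership of a feasible `X` in the closed hull needs work, and it splits by whether some
`B ∈ ℬ` is active at `X`.

Active case (`mem_closure_convexHull_of_matInner_eq_zero`): the vectors `x` with `x xᵀ ∈ F` form a
subspace `V`, and `X` is a sum of matrices `x xᵀ` with `x ∈ V` isotropic for `B` (rotation argument
of Sturm–Zhang type). If the last entry of `x` is nonzero, rescaling gives `(u, 1)` with `q u B =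
0`, which is feasible by the second assumption. If it is zero, non-affinity of `q(·, B)` makes `x` a
limit of isotropic vectors with nonzero last entry (`mem_closure_isotropic_of_ker`).

Inactive case: by the identity for `𝒜`, `X` is a limit of hull points still satisfying `ℬ`. Segments
inside the hull either end at feasible points or meet the active case, and convexity does the rest
(`mem_of_mem_convexHull_of_nonneg`). -/

/-- `matInner A` as a linear map. -/
def matInnerLin {n : ℕ} (A : Matrix (Fin n) (Fin n) ℝ) : Matrix (Fin n) (Fin n) ℝ →ₗ[ℝ] ℝ where
  toFun := matInner A
  map_add' X Y := by simp [matInner, mul_add, Finset.sum_add_distrib]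
  map_smul' c X := by simp [matInner, Finset.mul_sum, mul_left_comm]

@[simp] lemma matInnerLin_apply {n : ℕ} (A X : Matrix (Fin n) (Fin n) ℝ) :
    matInnerLin A X = matInner A X := rfl

lemma matInner_add {n : ℕ} (A X Y : Matrix (Fin n) (Fin n) ℝ) :
    matInner A (X + Y) = matInner A X + matInner A Y := map_add (matInnerLin A) X Y

lemma matInner_smul {n : ℕ} (A X : Matrix (Fin n) (Fin n) ℝ) (c : ℝ) :
    matInner A (c • X) = c * matInner A X := map_smul (matInnerLin A) c X

lemma continuous_matInner {n : ℕ} (A : Matrix (Fin n) (Fin n) ℝ) : Continuous (matInner A) := by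
  unfold matInner
  fun_prop

lemma matInner_vecMulVec {n : ℕ} (A : Matrix (Fin n) (Fin n) ℝ) (x y : Fin n → ℝ) :
    matInner A (vecMulVec x y) = toBilin' A x y := by
  simp only [matInner, toBilin'_apply, vecMulVec_apply]
  exact Finset.sum_congr rfl fun i _ => Finset.sum_congr rfl fun j _ => by ring

lemma toBilin'_comm {n : ℕ} {A : Matrix (Fin n) (Fin n) ℝ} (hA : A.IsSymm) (x y : Fin n → ℝ) :
    toBilin' A x y = toBilin' A y x := by
  simp only [toBilin'_apply]
  rw [Finset.sum_comm]
  exact Finset.sum_congr rfl fun i _ => Finset.sum_congr rfl fun j _ => by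
    rw [← hA.apply i j]; ring

lemma vecMulVec_self_mem_psdCone {n : ℕ} (x : Fin n → ℝ) : vecMulVec x x ∈ psdCone n := by
  have := posSemidef_vecMulVec_self_star (R := ℝ) x
  rwa [star_trivial] at this

lemma vecMulVec_smul_self {n : ℕ} (c : ℝ) (x : Fin n → ℝ) :
    vecMulVec (c • x) (c • x) = (c * c) • vecMulVec x x := by
  rw [smul_vecMulVec, vecMulVec_smul, smul_smul]

lemma continuous_vecMulVec_self {n : ℕ} : Continuous fun x : Fin n → ℝ => vecMulVec x x := by
  refine continuous_matrix fun i j => ?_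
  simp only [vecMulVec_apply]
  fun_prop

/-! ### Faces as subspaces, and isotropic rank-one decompositions -/

/-- The subspace of vectors `x` with `x xᵀ` in a face `F` of the positive semidefinite cone. -/
def faceVectors {n : ℕ} (F : PointedCone ℝ (Matrix (Fin n) (Fin n) ℝ))
    (hF : F.IsFaceOf (psdCone n)) : Submodule ℝ (Fin n → ℝ) where
  carrier := {x | vecMulVec x x ∈ F}
  zero_mem' := by simp
  smul_mem' c x hx := by
    simp only [Set.mem_ofPred_eq] at hx ⊢
    rw [vecMulVec_smul_self]
    exact F.smul_mem (mul_self_nonneg c) hx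
  add_mem' {x y} hx hy := by
    simp only [Set.mem_ofPred_eq] at hx hy ⊢
    -- Parallelogram law: `x + y` and `x - y` together give a matrix of `F`, so the face property
    -- puts each summand in `F`.
    refine hF.mem_of_add_mem_left (vecMulVec_self_mem_psdCone (x + y))
      (vecMulVec_self_mem_psdCone (x - y)) ?_
    have h : vecMulVec (x + y) (x + y) + vecMulVec (x - y) (x - y) =
        (vecMulVec x x + vecMulVec y y) + (vecMulVec x x + vecMulVec y y) := by
      ext i j
      simp only [Matrix.add_apply, vecMulVec_apply, Pi.add_apply, Pi.sub_apply]
      ring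
    rw [h]
    exact F.add_mem (F.add_mem hx hy) (F.add_mem hx hy)

/-- The matrices `x xᵀ` with `x ∈ V` isotropic for `B`. -/
def isotropicRankOne {n : ℕ} (B : Matrix (Fin n) (Fin n) ℝ) (V : Set (Fin n → ℝ)) :
    Set (Matrix (Fin n) (Fin n) ℝ) :=
  (fun x => vecMulVec x x) '' {x | x ∈ V ∧ toBilin' B x x = 0}

lemma exists_rotation_isotropic {n : ℕ} (B : Matrix (Fin n) (Fin n) ℝ) {x y : Fin n → ℝ}
    (hx : 0 < toBilin' B x x) (hy : toBilin' B y y < 0) :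
    ∃ c s : ℝ, c ^ 2 + s ^ 2 = 1 ∧ toBilin' B (c • x + s • y) (c • x + s • y) = 0 := by
  have hcont : Continuous fun θ : ℝ =>
      toBilin' B (Real.cos θ • x + Real.sin θ • y) (Real.cos θ • x + Real.sin θ • y) := by
    simp only [map_add, map_smul, LinearMap.add_apply, LinearMap.smul_apply, smul_eq_mul]
    fun_prop
  obtain ⟨θ, -, hθ⟩ := intermediate_value_Icc' (a := 0) (b := Real.pi / 2) (by positivity)
    hcont.continuousOn (show (0 : ℝ) ∈ Set.Icc _ _ by simp [hx.le, hy.le])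
  exact ⟨Real.cos θ, Real.sin θ, Real.cos_sq_add_sin_sq θ, hθ⟩

lemma vecMulVec_rotation {n : ℕ} {c s : ℝ} (h : c ^ 2 + s ^ 2 = 1) (x y : Fin n → ℝ) :
    vecMulVec (c • x + s • y) (c • x + s • y) + vecMulVec (c • y - s • x) (c • y - s • x) =
      vecMulVec x x + vecMulVec y y := by
  ext i j
  simp only [Matrix.add_apply, vecMulVec_apply, Pi.add_apply, Pi.sub_apply, Pi.smul_apply,
    smul_eq_mul]
  linear_combination (x i * x j + y i * y j) * h

/-- If not all terms are isotropic, two have opposite signs. Rotating that pair preserves the sum of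
their rank-one matrices and can make one of them isotropic; it is split off, and the other replaces
the pair, so the number of terms drops by one while the total form stays zero. -/
lemma sum_vecMulVec_mem_closure_isotropic {n : ℕ} (B : Matrix (Fin n) (Fin n) ℝ)
    (V : Submodule ℝ (Fin n → ℝ)) {ι : Type*} [DecidableEq ι] (k : ℕ) :
    ∀ (t : Finset ι) (x : ι → Fin n → ℝ), t.card = k → (∀ i ∈ t, x i ∈ V) →
      ∑ i ∈ t, toBilin' B (x i) (x i) = 0 →
      ∑ i ∈ t, vecMulVec (x i) (x i) ∈
        AddSubmonoid.closure (isotropicRankOne B (V : Set (Fin n → ℝ))) := by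
  induction k with
  | zero =>
    intro t x ht _ _
    rw [Finset.card_eq_zero.1 ht, Finset.sum_empty]
    exact zero_mem _
  | succ k ih =>
    intro t x ht hV h0
    by_cases hall : ∀ i ∈ t, toBilin' B (x i) (x i) = 0
    · exact sum_mem fun i hi => AddSubmonoid.subset_closure ⟨x i, ⟨hV i hi, hall i hi⟩, rfl⟩
    push Not at hall
    obtain ⟨i, hi, hpos⟩ := Finset.exists_pos_of_sum_zero_of_exists_nonzero _ h0 hall
    obtain ⟨j, hj, hneg⟩ : ∃ j ∈ t, toBilin' B (x j) (x j) < 0 := by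
      by_contra! hcon
      exact hpos.ne' ((Finset.sum_eq_zero_iff_of_nonneg hcon).1 h0 i hi)
    have hij : j ≠ i := by rintro rfl; exact lt_asymm hpos hneg
    obtain ⟨c, s, hcs, hiso⟩ := exists_rotation_isotropic B hpos hneg
    set y := c • x i + s • x j
    set z := c • x j - s • x i with hz
    have hrot : vecMulVec y y + vecMulVec z z = vecMulVec (x i) (x i) + vecMulVec (x j) (x j) :=
      vecMulVec_rotation hcs _ _
    have hform : toBilin' B z z = toBilin' B (x i) (x i) + toBilin' B (x j) (x j) := by
      simp only [← matInner_vecMulVec, ← matInner_add, ← hrot]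
      simp only [matInner_add, matInner_vecMulVec, hiso, zero_add]
    have hji : j ∈ t.erase i := Finset.mem_erase.2 ⟨hij, hj⟩
    -- The target `M` is left general to serve both the values of the form and the rank-one
    -- matrices.
    have key : ∀ {M : Type} [AddCommMonoid M] (f : (Fin n → ℝ) → M),
        ∑ l ∈ t.erase i, f (Function.update x j z l) =
          f z + ∑ l ∈ (t.erase i).erase j, f (x l) := by
      intro M _ f
      rw [← Finset.add_sum_erase _ _ hji, Function.update_self]
      congr 1
      refine Finset.sum_congr rfl fun l hl => ?_
      rw [Function.update_of_ne (Finset.ne_of_mem_erase hl)]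
    have split : ∀ {M : Type} [AddCommMonoid M] (f : (Fin n → ℝ) → M),
        ∑ l ∈ t, f (x l) = (f (x i) + f (x j)) + ∑ l ∈ (t.erase i).erase j, f (x l) := by
      intro M _ f
      rw [← Finset.add_sum_erase _ _ hi, ← Finset.add_sum_erase _ _ hji, add_assoc]
    have hrec := ih (t.erase i) (Function.update x j z)
      (by rw [Finset.card_erase_of_mem hi, ht]; rfl)
      (fun l hl => by
        rcases eq_or_ne l j with rfl | hl'
        · rw [Function.update_self]
          exact V.sub_mem (V.smul_mem _ (hV _ hj)) (V.smul_mem _ (hV _ hi))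
        · rw [Function.update_of_ne hl']
          exact hV l (Finset.mem_of_mem_erase hl))
      (by rw [key fun v => toBilin' B v v, hform, ← h0, split fun v => toBilin' B v v])
    rw [key fun v => vecMulVec v v] at hrec
    rw [split fun v => vecMulVec v v, ← hrot, add_assoc]
    exact add_mem (AddSubmonoid.subset_closure
      ⟨y, ⟨V.add_mem (V.smul_mem _ (hV _ hi)) (V.smul_mem _ (hV _ hj)), hiso⟩, rfl⟩) hrec

/-- A matrix of a face of the positive semidefinite cone that is orthogonal to `B` is a sum of
rank-one matrices of the face that are orthogonal to `B`. -/
lemma mem_closure_isotropic_of_mem_face {n : ℕ} {F : PointedCone ℝ (Matrix (Fin n) (Fin n) ℝ)}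
    (hF : F.IsFaceOf (psdCone n)) (B : Matrix (Fin n) (Fin n) ℝ) {X : Matrix (Fin n) (Fin n) ℝ}
    (hX : X ∈ F) (hBX : matInner B X = 0) :
    X ∈ AddSubmonoid.closure
      (isotropicRankOne B (faceVectors F hF : Set (Fin n → ℝ))) := by
  obtain ⟨k, x, rfl⟩ := posSemidef_iff_eq_sum_vecMulVec.1 (hF.le hX)
  simp only [star_trivial] at hX hBX ⊢
  refine sum_vecMulVec_mem_closure_isotropic B _ _ Finset.univ x rfl (fun i _ => ?_) ?_
  · exact hF.mem_of_sum_mem (fun i => vecMulVec_self_mem_psdCone (x i)) hX i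
  · simp only [← matInner_vecMulVec, ← hBX]
    exact (map_sum (matInnerLin B) _ _).symm

/-! ### Moving isotropic vectors off a hyperplane -/

/-- An isotropic vector `w` of a symmetric form, lying in the kernel of a functional `l`, is a limit
of isotropic vectors outside of the kernel, provided that there is some isotropic vector outside of
the kernel and that the form does not vanish on the kernel. -/
lemma mem_closure_isotropic_of_ker {n : ℕ} {B : Matrix (Fin n) (Fin n) ℝ} (hB : B.IsSymm)
    (V : Submodule ℝ (Fin n → ℝ)) (l : (Fin n → ℝ) →ₗ[ℝ] ℝ) {w x v : Fin n → ℝ}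
    (hw : w ∈ V) (hx : x ∈ V) (hv : v ∈ V) (hlw : l w = 0) (hlx : l x ≠ 0) (hlv : l v = 0)
    (hbw : toBilin' B w w = 0) (hbx : toBilin' B x x = 0) (hbv : toBilin' B v v ≠ 0) :
    w ∈ closure {y | (y ∈ V ∧ l y ≠ 0) ∧ toBilin' B y y = 0} := by
  have hne : ∀ a : ℝ, ∀ᶠ t in 𝓝[≠] (0 : ℝ), t ≠ a := by
    intro a
    rcases eq_or_ne a 0 with rfl | ha
    · exact self_mem_nhdsWithin
    · exact eventually_nhdsWithin_of_eventually_nhds (eventually_ne_nhds ha.symm)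
  by_cases hβ : toBilin' B w x = 0
  · have hlim : Tendsto (fun t : ℝ => w + t • x) (𝓝[≠] 0) (𝓝 w) := by
      have : ContinuousAt (fun t : ℝ => w + t • x) 0 := by fun_prop
      simpa [ContinuousAt] using this.tendsto.mono_left (nhdsWithin_le_nhds (s := {0}ᶜ))
    refine mem_closure_of_tendsto hlim ((hne 0).mono fun t ht => ⟨⟨?_, ?_⟩, ?_⟩)
    · exact V.add_mem hw (V.smul_mem _ hx)
    · simp [hlw, ht, hlx]
    · simp [hbw, hbx, hβ, toBilin'_comm hB x w]
  set β := toBilin' B w x with hβd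
  set γ := toBilin' B v v with hγd
  set p := toBilin' B w v with hp
  set r := toBilin' B x v with hr
  -- Since `x` is isotropic, the equation making `w + σ • x + t • v` isotropic is linear in `σ`;
  -- this is its solution. As `l` takes the value `σ t * l x` there, it remains to avoid the zeros
  -- `t = 0` and `t = -2p/γ` of the numerator.
  let σ : ℝ → ℝ := fun t => -(2 * t * p + t ^ 2 * γ) / (2 * β + 2 * t * r)
  have hσ0 : σ 0 = 0 := by simp [σ]
  have hden0 : (2 * β + 2 * 0 * r : ℝ) ≠ 0 := by simpa using hβ
  have hσc : ContinuousAt σ 0 := by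
    have h1 : ContinuousAt (fun t : ℝ => -(2 * t * p + t ^ 2 * γ)) 0 := by fun_prop
    have h2 : ContinuousAt (fun t : ℝ => 2 * β + 2 * t * r) 0 := by fun_prop
    exact h1.div h2 hden0
  have hlim : Tendsto (fun t : ℝ => w + σ t • x + t • v) (𝓝[≠] 0) (𝓝 w) := by
    have : ContinuousAt (fun t : ℝ => w + σ t • x + t • v) 0 := by fun_prop
    simpa [ContinuousAt, hσ0] using this.tendsto.mono_left (nhdsWithin_le_nhds (s := {0}ᶜ))
  have hden : ∀ᶠ t in 𝓝[≠] (0 : ℝ), 2 * β + 2 * t * r ≠ 0 := by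
    have h2 : ContinuousAt (fun t : ℝ => 2 * β + 2 * t * r) 0 := by fun_prop
    exact eventually_nhdsWithin_of_eventually_nhds (h2.eventually_ne hden0)
  refine mem_closure_of_tendsto hlim ?_
  filter_upwards [hne 0, hne (-(2 * p) / γ), hden] with t ht0 ht1 ht2
  have hnum : -(2 * t * p + t ^ 2 * γ) ≠ 0 := by
    intro h
    apply ht1
    rw [eq_div_iff hbv]
    have : t * (2 * p + t * γ) = 0 := by linear_combination -h
    rcases mul_eq_zero.1 this with h | h
    · exact absurd h ht0
    · linear_combination h
  have hσ : σ t * (2 * β + 2 * t * r) = -(2 * t * p + t ^ 2 * γ) := div_mul_cancel₀ _ ht2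
  refine ⟨⟨?_, ?_⟩, ?_⟩
  · exact V.add_mem (V.add_mem hw (V.smul_mem _ hx)) (V.smul_mem _ hv)
  · simp only [map_add, map_smul, hlw, hlv, smul_eq_mul, zero_add, mul_zero, add_zero]
    exact mul_ne_zero (div_ne_zero hnum ht2) hlx
  · simp only [map_add, map_smul, LinearMap.add_apply, LinearMap.smul_apply, smul_eq_mul,
      hbw, hbx, toBilin'_comm hB x w, toBilin'_comm hB v w, toBilin'_comm hB v x,
      ← hβd, ← hγd, ← hp, ← hr]
    linear_combination hσ

/-! ### Convex hulls cut by finitely many half-spaces -/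

/-- If the points of `convexHull ℝ P` at which finitely many continuous affine functions are
nonnegative and one of them vanishes lie in the convex set `R`, and so do the points of `P` at which
all of them are nonnegative, then all points of `convexHull ℝ P` at which they are nonnegative lie
in `R`. -/
lemma mem_of_mem_convexHull_of_nonneg {E ι : Type*} [AddCommGroup E] [Module ℝ E]
    {T : Set ι} (hT : T.Finite) (f : ι → E →ₗ[ℝ] ℝ) {P R : Set E} (hR : Convex ℝ R)
    (hP : ∀ y ∈ P, (∀ i ∈ T, 0 ≤ f i y) → y ∈ R)
    (hbd : ∀ y ∈ convexHull ℝ P, (∀ i ∈ T, 0 ≤ f i y) → (∃ i ∈ T, f i y = 0) → y ∈ R)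
    {y : E} (hy : y ∈ convexHull ℝ P) (hfy : ∀ i ∈ T, 0 ≤ f i y) : y ∈ R := by
  have hit : ∀ x ∈ convexHull ℝ P, ∀ z ∈ convexHull ℝ P, (∀ i ∈ T, 0 ≤ f i x) →
      ((∀ i ∈ T, 0 ≤ f i z) → z ∈ R) →
      ∃ u ∈ Set.Icc (0 : ℝ) 1, x + u • (z - x) ∈ R := by
    intro x hx z hz hfx hzR
    by_cases hfz : ∀ i ∈ T, 0 ≤ f i z
    · exact ⟨1, by simp, by simpa using hzR hfz⟩
    push Not at hfz
    obtain ⟨i, hi, hneg⟩ := hfz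
    have hne : hT.toFinset.Nonempty := ⟨i, hT.mem_toFinset.2 hi⟩
    let g : ℝ → ℝ := fun u => hT.toFinset.inf' hne fun i => f i (x + u • (z - x))
    have hg : Continuous g := by
      refine Continuous.finset_inf'_apply hne fun i _ => ?_
      simp only [map_add, map_smul, smul_eq_mul]
      fun_prop
    have h0 : 0 ≤ g 0 := (Finset.le_inf'_iff _ _).2 fun i hi => by
      simpa using hfx i (hT.mem_toFinset.1 hi)
    have h1 : g 1 ≤ 0 :=
      (Finset.inf'_le _ (hT.mem_toFinset.2 hi)).trans (by simpa using hneg.le)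
    -- At a zero of the minimum, all constraints hold and one is active.
    obtain ⟨u, hu, hgu⟩ := intermediate_value_Icc' zero_le_one hg.continuousOn
      (show (0 : ℝ) ∈ Set.Icc _ _ from ⟨h1, h0⟩)
    refine ⟨u, hu, hbd _ ?_ ?_ ?_⟩
    · exact (convex_convexHull ℝ P).add_smul_sub_mem hx hz hu
    · intro j hj
      exact hgu.ge.trans (Finset.inf'_le _ (hT.mem_toFinset.2 hj))
    · obtain ⟨j, hj, hgj⟩ := Finset.exists_mem_eq_inf' hne fun i => f i (x + u • (z - x))
      exact ⟨j, hT.mem_toFinset.1 hj, hgj.symm.trans hgu⟩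
  -- The implication "feasible implies in `R`" passes to convex combinations: from a feasible `x`
  -- between `a` and `b`, `hit` finds points of `R` towards both ends, and `x` lies between them.
  have hW : Convex ℝ {y | y ∈ convexHull ℝ P ∧ ((∀ i ∈ T, 0 ≤ f i y) → y ∈ R)} := by
    rintro a ⟨ha, haR⟩ b ⟨hb, hbR⟩ α β hα hβ hαβ
    have hx := convex_convexHull ℝ P ha hb hα hβ hαβ
    refine ⟨hx, fun hfx => ?_⟩
    obtain ⟨s, hs, hsR⟩ := hit _ hx a ha hfx haR
    obtain ⟨t, ht, htR⟩ := hit _ hx b hb hfx hbR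
    rcases hs.1.eq_or_lt with rfl | hs0
    · simpa using hsR
    rcases ht.1.eq_or_lt with rfl | ht0
    · simpa using htR
    have hpos : 0 < α * t + β * s := by
      rcases hα.eq_or_lt with rfl | hα0
      · have : β = 1 := by linarith
        simpa [this] using hs0
      · have := mul_nonneg hβ hs0.le
        have := mul_pos hα0 ht0
        linarith
    -- As `a - x = β (a - b)` and `b - x = -α (a - b)`, weights proportional to `α t` and `β s`
    -- cancel the displacements.
    have hmem := hR hsR htR (a := α * t / (α * t + β * s)) (b := β * s / (α * t + β * s))
      (by positivity) (by positivity) (by rw [← add_div, div_self hpos.ne'])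
    convert hmem using 1
    obtain rfl : β = 1 - α := by linarith
    match_scalars <;> field_simp <;> ring
  have hsub : P ⊆ {y | y ∈ convexHull ℝ P ∧ ((∀ i ∈ T, 0 ≤ f i y) → y ∈ R)} :=
    fun z hz => ⟨subset_convexHull ℝ P hz, hP z hz⟩
  exact (convexHull_min hsub hW hy).2 hfy

/-! ### Closedness and convexity of the feasible sets; optimal values -/

lemma matInner_H₁ {m : ℕ} (X : Matrix (Fin (m + 1)) (Fin (m + 1)) ℝ) :
    matInner (H₁ m) X = X (Fin.last m) (Fin.last m) := by
  simp [matInner, H₁, diagonal_apply, Pi.single_apply]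

lemma isSymm_of_mem_psdCone {n : ℕ} {X : Matrix (Fin n) (Fin n) ℝ} (hX : X ∈ psdCone n) :
    X.IsSymm := by
  have : X.PosSemidef := hX
  exact (conjTranspose_eq_transpose_of_trivial X).symm.trans this.1

lemma isClosed_psdCone (n : ℕ) : IsClosed (psdCone n : Set (Matrix (Fin n) (Fin n) ℝ)) := by
  have h : (psdCone n : Set (Matrix (Fin n) (Fin n) ℝ)) =
      {X | Xᴴ = X} ∩ ⋂ x : Fin n → ℝ, {X | 0 ≤ star x ⬝ᵥ X *ᵥ x} := by
    ext X
    simp only [Set.mem_inter_iff, Set.mem_iInter, Set.mem_ofPred_eq]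
    exact posSemidef_iff_dotProduct_mulVec
  rw [h]
  refine (isClosed_eq (by fun_prop) continuous_id).inter (isClosed_iInter fun x => ?_)
  exact isClosed_le continuous_const (by fun_prop)

lemma isClosed_Jplus {n : ℕ} (𝒞 : Set (Matrix (Fin n) (Fin n) ℝ)) : IsClosed (Jplus 𝒞) := by
  have h : Jplus 𝒞 = (psdCone n : Set _) ∩ ⋂ A ∈ 𝒞, {X | 0 ≤ matInner A X} := by
    ext X
    simp [Jplus]
  rw [h]
  exact (isClosed_psdCone n).inter (isClosed_biInter fun A _ =>
    isClosed_le continuous_const (continuous_matInner A))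

lemma convex_Jplus {n : ℕ} (𝒞 : Set (Matrix (Fin n) (Fin n) ℝ)) : Convex ℝ (Jplus 𝒞) := by
  rintro X ⟨hX, hX'⟩ Y ⟨hY, hY'⟩ a b ha hb hab
  refine ⟨(psdCone n).add_mem ((psdCone n).smul_mem ha hX) ((psdCone n).smul_mem hb hY),
    fun A hA => ?_⟩
  rw [matInner_add, matInner_smul, matInner_smul]
  exact add_nonneg (mul_nonneg ha (hX' A hA)) (mul_nonneg hb (hY' A hA))

lemma Jplus_inter_hyperplane₁ {m : ℕ} (𝒞 : Set (Matrix (Fin (m + 1)) (Fin (m + 1)) ℝ)) :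
    Jplus 𝒞 ∩ hyperplane₁ m = {X | X ∈ Jplus 𝒞 ∧ matInner (H₁ m) X = 1} := by
  ext X
  exact ⟨fun h => ⟨h.1, h.2.2⟩, fun h => ⟨h.1, isSymm_of_mem_psdCone h.1.1, h.2⟩⟩

lemma isClosed_Jplus_inter_hyperplane₁ {m : ℕ}
    (𝒞 : Set (Matrix (Fin (m + 1)) (Fin (m + 1)) ℝ)) : IsClosed (Jplus 𝒞 ∩ hyperplane₁ m) := by
  rw [Jplus_inter_hyperplane₁]
  exact (isClosed_Jplus 𝒞).inter (isClosed_eq (continuous_matInner _) continuous_const)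

lemma convex_Jplus_inter_hyperplane₁ {m : ℕ}
    (𝒞 : Set (Matrix (Fin (m + 1)) (Fin (m + 1)) ℝ)) : Convex ℝ (Jplus 𝒞 ∩ hyperplane₁ m) := by
  rw [Jplus_inter_hyperplane₁]
  exact (convex_Jplus 𝒞).inter (convex_hyperplane (matInnerLin (H₁ m)).isLinear 1)

lemma convexHull_rankOne_subset {m : ℕ} (𝒞 : Set (Matrix (Fin (m + 1)) (Fin (m + 1)) ℝ)) :
    convexHull ℝ (rankOne (m + 1) ∩ Jplus 𝒞 ∩ hyperplane₁ m) ⊆ Jplus 𝒞 ∩ hyperplane₁ m :=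
  convexHull_min (fun _ h => ⟨h.1.2, h.2⟩) (convex_Jplus_inter_hyperplane₁ 𝒞)

/-- An infimum of a linear function is not affected by passing to the closed convex hull. -/
lemma eta_eq_of_convexHullIdentity {m : ℕ} {𝒞 : Set (Matrix (Fin (m + 1)) (Fin (m + 1)) ℝ)}
    (h : ConvexHullIdentity 𝒞) (Q : Matrix (Fin (m + 1)) (Fin (m + 1)) ℝ) :
    eta (Jplus 𝒞) Q (H₁ m) = eta (rankOne (m + 1) ∩ Jplus 𝒞) Q (H₁ m) := by
  refine le_antisymm (sInf_le_sInf (Set.image_mono fun X hX => ⟨hX.1.2, hX.2⟩)) ?_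
  refine le_sInf ?_
  rintro _ ⟨X, hX, rfl⟩
  set c := eta (rankOne (m + 1) ∩ Jplus 𝒞) Q (H₁ m)
  have hX' : X ∈ closure (convexHull ℝ (rankOne (m + 1) ∩ Jplus 𝒞 ∩ hyperplane₁ m)) := by
    rw [← h, Jplus_inter_hyperplane₁]
    exact hX
  have hcl : IsClosed {X : Matrix (Fin (m + 1)) (Fin (m + 1)) ℝ | c ≤ (matInner Q X : ℝ)} :=
    isClosed_le continuous_const (continuous_coe_real_ereal.comp (continuous_matInner Q))
  have hconv : Convex ℝ {X : Matrix (Fin (m + 1)) (Fin (m + 1)) ℝ | c ≤ (matInner Q X : ℝ)} := by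
    have hr : Convex ℝ {r : ℝ | c ≤ (r : EReal)} :=
      Set.OrdConnected.convex ⟨fun a ha b _ x hx => le_trans ha (EReal.coe_le_coe_iff.2 hx.1)⟩
    exact hr.linear_preimage (matInnerLin Q)
  have hsub : rankOne (m + 1) ∩ Jplus 𝒞 ∩ hyperplane₁ m ⊆
      {X : Matrix (Fin (m + 1)) (Fin (m + 1)) ℝ | c ≤ (matInner Q X : ℝ)} :=
    fun Y hY => by
      have hY' : Y ∈ {X | X ∈ rankOne (m + 1) ∩ Jplus 𝒞 ∧ matInner (H₁ m) X = 1} :=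
        ⟨hY.1, hY.2.2⟩
      change sInf _ ≤ ((matInner Q Y : ℝ) : EReal)
      exact sInf_le (Set.mem_image_of_mem _ hY')
  exact closure_minimal (convexHull_min hsub hconv) hcl hX'

/-! ### Homogenization and the active-constraint case -/

lemma hom_eq_inv_smul {m : ℕ} {x : Fin (m + 1) → ℝ} (hx : x (Fin.last m) ≠ 0) :
    hom (fun i => (x (Fin.last m))⁻¹ * x i.castSucc) = (x (Fin.last m))⁻¹ • x := by
  ext i
  refine Fin.lastCases ?_ (fun j => ?_) i <;> simp [hom, hx]

lemma hom_eq_add {m : ℕ} (u v : Fin m → ℝ) :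
    hom u = hom v + Fin.snoc (α := fun _ => ℝ) (u - v) 0 := by
  ext i
  refine Fin.lastCases ?_ (fun j => ?_) i <;> simp [hom]

/-- `w ↦ (w, 0)` as a linear map. -/
def snocZero (m : ℕ) : (Fin m → ℝ) →ₗ[ℝ] (Fin (m + 1) → ℝ) where
  toFun w := Fin.snoc (α := fun _ => ℝ) w 0
  map_add' v w := by
    ext i
    refine Fin.lastCases ?_ (fun j => ?_) i <;> simp
  map_smul' c w := by
    ext i
    refine Fin.lastCases ?_ (fun j => ?_) i <;> simp

lemma snocZero_last {m : ℕ} (w : Fin m → ℝ) : snocZero m w (Fin.last m) = 0 := by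
  simp [snocZero]

lemma hom_last {m : ℕ} (u : Fin m → ℝ) : hom u (Fin.last m) = 1 := by simp [hom]

/-- If `q(·, B)` is not affine on `L₁(F)`, then the form of `B` does not vanish on the vectors of
the face with last entry zero. -/
lemma exists_ne_zero_of_not_isAffineOn {m : ℕ}
    {F : PointedCone ℝ (Matrix (Fin (m + 1)) (Fin (m + 1)) ℝ)} (hF : F.IsFaceOf (psdCone (m + 1)))
    {B : Matrix (Fin (m + 1)) (Fin (m + 1)) ℝ} (hB : B.IsSymm)
    (hquad : ¬ IsAffineOn (fun u => q u B) (L₁ F)) :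
    ∃ v ∈ faceVectors F hF, v (Fin.last m) = 0 ∧ toBilin' B v v ≠ 0 := by
  by_contra! hcon
  apply hquad
  rcases (L₁ F).eq_empty_or_nonempty with h | ⟨u₀, hu₀⟩
  · exact ⟨AffineMap.const ℝ _ 0, by simp [h]⟩
  -- The linear part of `q(·, B)` expanded about `u₀`; the quadratic remainder vanishes by `hcon`.
  let l : (Fin m → ℝ) →ₗ[ℝ] ℝ := (2 : ℝ) • (toBilin' B (hom u₀)).comp (snocZero m)
  refine ⟨l.toAffineMap + AffineMap.const ℝ _ (q u₀ B - l u₀), fun u hu => ?_⟩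
  have hdec : hom u = hom u₀ + snocZero m (u - u₀) := hom_eq_add u u₀
  have hmem : snocZero m (u - u₀) ∈ faceVectors F hF := by
    rw [← sub_eq_of_eq_add' hdec]
    exact (faceVectors F hF).sub_mem hu hu₀
  have h0 := hcon _ hmem (snocZero_last _)
  have hl : l u - l u₀ = 2 * toBilin' B (hom u₀) (snocZero m (u - u₀)) := by
    rw [← map_sub]
    rfl
  simp only [q, matInner_vecMulVec, AffineMap.coe_add, Pi.add_apply, LinearMap.coe_toAffineMap,
    AffineMap.coe_const, Function.const_apply]
  have hexp : toBilin' B (hom u) (hom u) =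
      toBilin' B (hom u₀) (hom u₀) + 2 * toBilin' B (hom u₀) (snocZero m (u - u₀)) := by
    rw [hdec]
    simp only [map_add, LinearMap.add_apply, h0, toBilin'_comm hB _ (hom u₀)]
    ring
  rw [hexp, ← hl]
  ring

/-- A sum of rank-one matrices proportional to elements of `S` is proportional to an element of the
convex hull of `S`. -/
lemma exists_smul_of_mem_closure {m : ℕ} {S N : Set (Matrix (Fin (m + 1)) (Fin (m + 1)) ℝ)}
    (hS : S.Nonempty) (hN : ∀ Y ∈ N, ∃ c : ℝ, 0 ≤ c ∧ ∃ Z ∈ S, Y = c • Z)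
    {Y : Matrix (Fin (m + 1)) (Fin (m + 1)) ℝ} (hY : Y ∈ AddSubmonoid.closure N) :
    ∃ c : ℝ, 0 ≤ c ∧ ∃ Z ∈ convexHull ℝ S, Y = c • Z := by
  induction hY using AddSubmonoid.closure_induction with
  | mem Y h =>
    obtain ⟨c, hc, Z, hZ, rfl⟩ := hN Y h
    exact ⟨c, hc, Z, subset_convexHull ℝ S hZ, rfl⟩
  | zero =>
    obtain ⟨Z, hZ⟩ := hS
    exact ⟨0, le_rfl, Z, subset_convexHull ℝ S hZ, by simp⟩
  | add Y Y' _ _ h h' =>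
    obtain ⟨c, hc, Z, hZ, rfl⟩ := h
    obtain ⟨c', hc', Z', hZ', rfl⟩ := h'
    obtain ⟨W, hW, hWeq⟩ := (convex_convexHull ℝ S).exists_mem_add_smul_eq hZ hZ' hc hc'
    exact ⟨c + c', add_nonneg hc hc', W, hW, hWeq.symm⟩

/-- A relaxed solution at which a constraint `B` is active lies in the closed convex hull of the
rank-one solutions. -/
lemma mem_closure_convexHull_of_matInner_eq_zero {m : ℕ}
    {𝒞 : Set (Matrix (Fin (m + 1)) (Fin (m + 1)) ℝ)}
    {F : PointedCone ℝ (Matrix (Fin (m + 1)) (Fin (m + 1)) ℝ)} (hF : F.IsFaceOf (psdCone (m + 1)))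
    {B : Matrix (Fin (m + 1)) (Fin (m + 1)) ℝ} (hB : B.IsSymm)
    (hNIQC : ∀ B' ∈ 𝒞, B ≠ B' → L₁ F ∩ zeroSet B ⊆ L₁ F ∩ nonnegSet B')
    (hquad : ¬ IsAffineOn (fun u => q u B) (L₁ F))
    {X : Matrix (Fin (m + 1)) (Fin (m + 1)) ℝ} (hXF : X ∈ F) (hX1 : matInner (H₁ m) X = 1)
    (hBX : matInner B X = 0) :
    X ∈ closure (convexHull ℝ (rankOne (m + 1) ∩ Jplus 𝒞 ∩ hyperplane₁ m)) := by
  set V := faceVectors F hF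
  set S := rankOne (m + 1) ∩ Jplus 𝒞 ∩ hyperplane₁ m
  let N := isotropicRankOne B {y : Fin (m + 1) → ℝ | y ∈ V ∧ y (Fin.last m) ≠ 0}
  have hNS : ∀ Y ∈ N, ∃ c : ℝ, 0 ≤ c ∧ ∃ Z ∈ S, Y = c • Z := by
    rintro _ ⟨x, ⟨⟨hxV, hx0⟩, hxB⟩, rfl⟩
    set u : Fin m → ℝ := fun i => (x (Fin.last m))⁻¹ * x i.castSucc
    have hu : hom u = (x (Fin.last m))⁻¹ • x := hom_eq_inv_smul hx0
    have huF : u ∈ L₁ F := by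
      change hom u ∈ V
      rw [hu]
      exact V.smul_mem _ hxV
    have huB : q u B = 0 := by
      rw [q, matInner_vecMulVec, hu]
      simp [hxB]
    refine ⟨x (Fin.last m) * x (Fin.last m), mul_self_nonneg _, vecMulVec (hom u) (hom u),
      ⟨⟨⟨hom u, rfl⟩, vecMulVec_self_mem_psdCone _, fun B' hB' => ?_⟩,
        isSymm_of_mem_psdCone (vecMulVec_self_mem_psdCone _), ?_⟩, ?_⟩
    · by_cases hBB : B = B'
      · subst hBB
        exact huB.ge
      · exact (hNIQC B' hB' hBB ⟨huF, huB⟩).2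
    · rw [matInner_H₁, vecMulVec_apply, hom_last, mul_one]
    · rw [← vecMulVec_smul_self, hu, smul_smul, mul_inv_cancel₀ hx0, one_smul]
  -- Otherwise every term of the isotropic decomposition of `X` has zero corner entry, contradicting
  -- `hX1`.
  obtain ⟨x, hxV, hx0, hxB⟩ : ∃ x ∈ V, x (Fin.last m) ≠ 0 ∧ toBilin' B x x = 0 := by
    by_contra! hcon
    have hle : AddSubmonoid.closure (isotropicRankOne B (V : Set (Fin (m + 1) → ℝ))) ≤
        AddMonoidHom.mker (matInnerLin (H₁ m)).toAddMonoidHom := by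
      rw [AddSubmonoid.closure_le]
      rintro _ ⟨y, ⟨hyV, hyB⟩, rfl⟩
      have hy : y (Fin.last m) = 0 := by
        by_contra hy
        exact hcon y hyV hy hyB
      change matInner (H₁ m) (vecMulVec y y) = 0
      rw [matInner_H₁, vecMulVec_apply, hy, mul_zero]
    have h0 : matInner (H₁ m) X = 0 := hle (mem_closure_isotropic_of_mem_face hF B hXF hBX)
    linarith
  obtain ⟨v, hvV, hv0, hvB⟩ := exists_ne_zero_of_not_isAffineOn hF hB hquad
  have hSne : S.Nonempty := by
    obtain ⟨-, -, Z, hZ, -⟩ := hNS _ ⟨x, ⟨⟨hxV, hx0⟩, hxB⟩, rfl⟩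
    exact ⟨Z, hZ⟩
  have hXcl : X ∈
      closure (AddSubmonoid.closure N : Set (Matrix (Fin (m + 1)) (Fin (m + 1)) ℝ)) := by
    have hle : AddSubmonoid.closure (isotropicRankOne B (V : Set (Fin (m + 1) → ℝ))) ≤
        (AddSubmonoid.closure N).topologicalClosure := by
      rw [AddSubmonoid.closure_le]
      rintro _ ⟨w, ⟨hwV, hwB⟩, rfl⟩
      change vecMulVec w w ∈ closure (AddSubmonoid.closure N : Set (Matrix _ _ ℝ))
      by_cases hw0 : w (Fin.last m) = 0
      · have := mem_closure_isotropic_of_ker hB V (LinearMap.proj (Fin.last m)) hwV hxV hvV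
          hw0 hx0 hv0 hwB hxB hvB
        exact map_mem_closure (f := fun y => vecMulVec y y) continuous_vecMulVec_self this
          fun y hy => AddSubmonoid.subset_closure ⟨y, hy, rfl⟩
      · exact subset_closure (AddSubmonoid.subset_closure ⟨w, ⟨⟨hwV, hw0⟩, hwB⟩, rfl⟩)
    exact hle (mem_closure_isotropic_of_mem_face hF B hXF hBX)
  have hopen : IsOpen {Y : Matrix (Fin (m + 1)) (Fin (m + 1)) ℝ | matInner (H₁ m) Y ≠ 0} :=
    isOpen_ne_fun (continuous_matInner _) continuous_const
  have hX0 : matInner (H₁ m) X ≠ 0 := by rw [hX1]; exact one_ne_zero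
  have hXcl' := hopen.inter_closure ⟨hX0, hXcl⟩
  -- Dividing by the corner entry is continuous near `X`, fixes `X`, and carries nearby elements of
  -- the cone generated by `N` into `convexHull ℝ S`.
  have hcont : ContinuousAt (fun Y : Matrix (Fin (m + 1)) (Fin (m + 1)) ℝ =>
      (matInner (H₁ m) Y)⁻¹ • Y) X :=
    ((continuous_matInner _).continuousAt.inv₀ hX0).smul continuousAt_id
  have := hcont.continuousWithinAt.mem_closure (t := convexHull ℝ S) hXcl' (by
    rintro Y ⟨hY0, hY⟩
    obtain ⟨c, hc, Z, hZ, rfl⟩ := exists_smul_of_mem_closure hSne hNS hY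
    have hZ1 : matInner (H₁ m) Z = 1 := (convexHull_rankOne_subset 𝒞 hZ).2.2
    rw [Set.mem_ofPred_eq, matInner_smul, hZ1, mul_one] at hY0
    simp only [matInner_smul, hZ1, mul_one, smul_smul]
    rw [inv_mul_cancel₀ hY0, one_smul]
    exact hZ)
  simpa [hX1] using this

end QCQP

/-! ### The main theorem -/

theorem theorem3p3 (m : ℕ) (𝒜 ℬ : Set (Matrix (Fin (m + 1)) (Fin (m + 1)) ℝ))
    (hAfin : 𝒜.Finite) (hBfin : ℬ.Finite)
    (hAsymm : ∀ A ∈ 𝒜, A.IsSymm) (hBsymm : ∀ B ∈ ℬ, B.IsSymm)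
    (F : PointedCone ℝ (Matrix (Fin (m + 1)) (Fin (m + 1)) ℝ))
    (hF : F.IsFaceOf (QCQP.psdCone (m + 1)))
    (hAF : QCQP.Jplus 𝒜 ⊆ (F : Set (Matrix (Fin (m + 1)) (Fin (m + 1)) ℝ)))
    (hhull : QCQP.ConvexHullIdentity 𝒜)
    (hNIQC : ∀ B ∈ ℬ, ∀ B' ∈ 𝒜 ∪ ℬ, B ≠ B' →
      QCQP.L₁ F ∩ QCQP.zeroSet B ⊆ QCQP.L₁ F ∩ QCQP.nonnegSet B')
    (hquad : ∀ B ∈ ℬ, ¬ QCQP.IsAffineOn (fun u => QCQP.q u B) (QCQP.L₁ F)) :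
    QCQP.ConvexHullIdentity (𝒜 ∪ ℬ) ∧
      ∀ Q : Matrix (Fin (m + 1)) (Fin (m + 1)) ℝ, Q.IsSymm →
        QCQP.eta (QCQP.Jplus (𝒜 ∪ ℬ)) Q (QCQP.H₁ m) =
          QCQP.eta (QCQP.rankOne (m + 1) ∩ QCQP.Jplus (𝒜 ∪ ℬ)) Q (QCQP.H₁ m) := by
  open QCQP in
  suffices h : ConvexHullIdentity (𝒜 ∪ ℬ) from ⟨h, fun Q _ => eta_eq_of_convexHullIdentity h Q⟩
  refine Set.Subset.antisymm ?_ (closure_minimal (convexHull_rankOne_subset _)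
    (isClosed_Jplus_inter_hyperplane₁ _))
  set R := closure (convexHull ℝ (rankOne (m + 1) ∩ Jplus (𝒜 ∪ ℬ) ∩ hyperplane₁ m))
  have hRconv : Convex ℝ R := (convex_convexHull ℝ _).closure
  have hactive : ∀ X ∈ Jplus 𝒜 ∩ hyperplane₁ m, (∃ B ∈ ℬ, matInner B X = 0) → X ∈ R := by
    rintro X ⟨hXA, hX1⟩ ⟨B, hB, hBX⟩
    exact mem_closure_convexHull_of_matInner_eq_zero hF (hBsymm B hB) (hNIQC B hB) (hquad B hB)
      (hAF hXA) hX1.2 hBX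
  have hfeas : ∀ X ∈ convexHull ℝ (rankOne (m + 1) ∩ Jplus 𝒜 ∩ hyperplane₁ m),
      (∀ B ∈ ℬ, 0 ≤ matInner B X) → X ∈ R := by
    intro X hX hXB
    refine mem_of_mem_convexHull_of_nonneg hBfin matInnerLin hRconv ?_ ?_ hX hXB
    · rintro Y ⟨⟨hY, hYA⟩, hY1⟩ hYB
      exact subset_closure (subset_convexHull ℝ _
        ⟨⟨hY, hYA.1, fun A hA => hA.elim (hYA.2 A) (hYB A)⟩, hY1⟩)
    · exact fun Y hY _ h => hactive Y (convexHull_rankOne_subset 𝒜 hY) h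
  rintro X ⟨hX, hX1⟩
  have hXA : X ∈ Jplus 𝒜 ∩ hyperplane₁ m := ⟨⟨hX.1, fun A hA => hX.2 A (Or.inl hA)⟩, hX1⟩
  by_cases hzero : ∃ B ∈ ℬ, matInner B X = 0
  · exact hactive X hXA hzero
  push Not at hzero
  -- Strict positivity on the finite set `ℬ` is an open condition, so the approximating hull points
  -- can be chosen to satisfy it too.
  have hopen : IsOpen (⋂ B ∈ ℬ, {Y : Matrix (Fin (m + 1)) (Fin (m + 1)) ℝ | 0 < matInner B Y}) :=
    hBfin.isOpen_biInter fun B _ => isOpen_lt continuous_const (continuous_matInner B)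
  have hXpos : X ∈ ⋂ B ∈ ℬ, {Y : Matrix (Fin (m + 1)) (Fin (m + 1)) ℝ | 0 < matInner B Y} :=
    Set.mem_iInter₂.2 fun B hB => lt_of_le_of_ne (hX.2 B (Or.inr hB)) (hzero B hB).symm
  rw [hhull] at hXA
  refine closure_minimal ?_ isClosed_closure (hopen.inter_closure ⟨hXpos, hXA⟩)
  rintro Y ⟨hY, hYP⟩
  exact hfeas Y hYP fun B hB => le_of_lt (Set.mem_iInter₂.1 hY B hB)
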